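/- Let $n\ge 10^{10}$ be an integer. Call the squarefree integers in $\{1,\dots,n\}$ vertices, and set $$K=K(n)=0.672\cdot\frac13\cdot\frac{6}{\pi^2}\,n .$$ Then the following hold. (a) For each integer $k$ with $0\le k\le K$, there are at most $k$ odd vertices that are each coprime to at most $k$ even vertices. (b) For each odd vertex $\ell$ that is coprime to exactly $k$ even vertices, where $k>K$, there are at most $k$ odd vertices $\ell'$ with $\gcd(\ell,\ell')>1$ (where $\ell'=\ell$ is allowed). -/

import Mathlib

/-- The vertices of the squarefree graph up to `n`: the squarefree numbers in `{1, …, n}`. -/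
def vertices (n : ℕ) : Finset ℕ :=
  (Finset.Icc 1 n).filter (fun a => Squarefree a)

/-- The odd vertices of the squarefree graph up to `n`. -/
def oddVertices (n : ℕ) : Finset ℕ :=
  (vertices n).filter (fun a => Odd a)

/-- The even vertices of the squarefree graph up to `n`. -/
def evenVertices (n : ℕ) : Finset ℕ :=
  (vertices n).filter (fun a => Even a)

/-- `evenCoprimeCount l n` is the number of even vertices that are coprime to `l`. -/
def evenCoprimeCount (l n : ℕ) : ℕ :=
  ((evenVertices n).filter (fun b => Nat.Coprime l b)).card

/-- `oddSharingCount l n` is the number of odd vertices that share a factor with `l`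
(counting `l` itself if `l ≠ 1`). -/
def oddSharingCount (l n : ℕ) : ℕ :=
  ((oddVertices n).filter (fun m => ¬ Nat.Coprime l m)).card

/-- The threshold `K(n) = 0.672 · (1/3) · (6/π²) · n`. -/
noncomputable def threshold (n : ℕ) : ℝ :=
  0.672 * ((1 / 3) * (6 / Real.pi ^ 2 * (n : ℝ)))

/-!
Write `E = (2/π²) n`, and for an odd squarefree `l` put `f(l) = ∏_{p ∣ l} p/(p+1)`. Even vertices
coprime to `l` correspond, by halving, to odd squarefree numbers up to `n/2` coprime to `l`, so
`l` is coprime to about `E f(l)` even vertices, and likewise to about `2 E f(l)` odd vertices.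

*Error terms.* Möbius inversion gives `(4/π²) x + O(√x)` for the number of odd squarefree numbers
up to `x`, with constant `7/8`. To exclude the multiples of a further odd prime `p`, let `A` and
`A'` be the counts before and after: `A(x) = A'(x) + A'(x/p)`. Solving this recursion in `x`
multiplies the main term by `p/(p+1)` and the error term by `1/(1 - p^{-1/2})`
(`abs_card_oddSquarefreeAvoiding_sub_le`). Inclusion-exclusion over the divisors of `l` would cost
a factor `2` for each prime. The product of `(1 + 1/p)/(1 - p^{-1/2})` over `p ∣ l` is at most
`12.2 l^{1/10}`, so for `l ≤ n` and `n ≥ 10^10` all errors are at most `0.0011 f(l) n`.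

*Vertices of large degree.* If `l` is coprime to more than `K = 0.672 E` even vertices, then
`f(l)` is essentially at least `0.672`, and about `2 E (1 - f(l)) ≤ 0.656 E` odd vertices share a
factor with `l`. The gap of `0.016 E` absorbs the error terms.

*Vertices of small degree.* If `l` is coprime to at most `k` even vertices, then
`1/f(l) = ∏_{p ∣ l} (1 + 1/p)` is at least `t = 0.2018 n / k`, and `t ≥ 1.48` as `k ≤ K`. Split the
odd vertices by `gcd(l, 15) ∈ {1, 3, 5, 15}`, which determines the contribution of the primes `3` and
`5` to the product; the remaining factor is `τ(l) = ∑ 1/d` over the divisors `d` of `l` coprime to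
`30`. The sum of `τ(l) - 1` over a class is controlled by `∑_{d > 1} 1/d²` over `d` coprime to
`30`, which is below `0.066`. Markov's inequality in each class bounds the number of
such `l` by `k` (`card_filter_evenCoprimeCount_le`).
-/

/-! ### The number of odd squarefree numbers up to `x` -/

open ArithmeticFunction in
/-- This is the value at `2` of the inverse of the `L`-function of the trivial character mod `2`. -/
theorem hasSum_moebius_odd_div_sq :
    HasSum (fun j : ℕ => (moebius (2 * j + 1) : ℝ) / (2 * (j : ℝ) + 1) ^ 2) (8 / Real.pi ^ 2) := by
  set χ : DirichletCharacter ℂ 2 := 1 with hχ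
  have h2 : (1 : ℝ) < (2 : ℂ).re := by norm_num
  have hsum : LSeriesSummable ((fun n : ℕ => χ n) * fun n : ℕ => (moebius n : ℂ)) 2 := by
    refine LSeriesSummable_of_bounded_of_one_lt_re (m := 1) (fun n _ => ?_) h2
    rw [Pi.mul_apply, norm_mul]
    have h1 : ‖((moebius n : ℤ) : ℂ)‖ ≤ 1 := by
      rw [Complex.norm_intCast]
      exact_mod_cast abs_moebius_le_one
    exact mul_le_one₀ (χ.norm_le_one _) (norm_nonneg _) h1
  have hval : LSeries ((fun n : ℕ => χ n) * fun n : ℕ => (moebius n : ℂ)) 2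
      = ((8 / Real.pi ^ 2 : ℝ) : ℂ) := by
    have hmul := DirichletCharacter.LSeries.mul_mu_eq_one χ h2
    have hL : LSeries (fun n : ℕ => χ n) 2 = ((Real.pi ^ 2 / 8 : ℝ) : ℂ) := by
      rw [← DirichletCharacter.LFunction_eq_LSeries χ h2]
      have h := DirichletCharacter.LFunctionTrivChar_eq_mul_riemannZeta (N := 2) (s := 2)
        (by norm_num)
      rw [DirichletCharacter.LFunctionTrivChar, riemannZeta_two,
        Nat.Prime.primeFactors Nat.prime_two, Finset.prod_singleton] at h
      rw [hχ, h]
      have : ((2 : ℕ) : ℂ) ^ (-2 : ℂ) = 1 / 4 := by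
        rw [Complex.cpow_neg]
        have : ((2 : ℕ) : ℂ) ^ (2 : ℂ) = ((2 : ℕ) : ℂ) ^ (2 : ℕ) := by
          exact_mod_cast Complex.cpow_natCast (2 : ℂ) 2
        rw [this]; norm_num
      rw [this]; push_cast; ring
    rw [hL] at hmul
    have hpi : (Real.pi : ℂ) ≠ 0 := by exact_mod_cast Real.pi_ne_zero
    push_cast at hmul ⊢
    field_simp at hmul ⊢
    linear_combination hmul
  have hs := hsum.LSeriesHasSum
  rw [hval, LSeriesHasSum] at hs
  have hinj : Function.Injective (fun j : ℕ => 2 * j + 1) := fun a b h => by simpa using h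
  rw [← hinj.hasSum_iff] at hs
  · rw [← Complex.hasSum_ofReal]
    convert hs using 2 with j
    rw [Function.comp, LSeries.term_of_ne_zero (by omega), Pi.mul_apply]
    have h1 : χ ((2 * j + 1 : ℕ) : ZMod 2) = 1 := by
      have : ((2 * j + 1 : ℕ) : ZMod 2) = 1 := by
        push_cast
        rw [show (2 : ZMod 2) = 0 from rfl]; ring
      rw [this, map_one]
    rw [h1, one_mul]
    have : (((2 * j + 1 : ℕ) : ℂ)) ^ (2 : ℂ) = ((2 * j + 1 : ℕ) : ℂ) ^ (2 : ℕ) := by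
      exact_mod_cast Complex.cpow_natCast ((2 * j + 1 : ℕ) : ℂ) 2
    rw [this]; push_cast; rfl
  · intro n hn
    have he : Even n := by
      by_contra h
      rw [Nat.not_even_iff_odd] at h
      obtain ⟨k, hk⟩ := h
      exact hn ⟨k, hk.symm⟩
    rcases eq_or_ne n 0 with rfl | h0
    · simp
    · rw [LSeries.term_of_ne_zero h0, Pi.mul_apply]
      have : χ (n : ZMod 2) = 0 := by
        rw [(ZMod.natCast_eq_zero_iff_even).2 he]
        exact χ.map_nonunit (by simp)
      rw [this]; simp

theorem Nat.dvd_of_sq_dvd_sq_mul_squarefree {a b d : ℕ} (ha : Squarefree a) (hb : 0 < b)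
    (h : d ^ 2 ∣ b ^ 2 * a) : d ∣ b := by
  obtain ⟨g, d', b', hg, hcop, rfl, rfl⟩ := Nat.exists_coprime' (Nat.gcd_pos_of_pos_right d hb)
  rw [mul_pow, mul_pow, mul_right_comm] at h
  have h1 : d' ^ 2 ∣ b' ^ 2 * a := Nat.dvd_of_mul_dvd_mul_right (by positivity) h
  have h2 : d' ^ 2 ∣ a := (Nat.Coprime.pow 2 2 hcop).dvd_of_dvd_mul_left h1
  have h3 : d' = 1 := by
    rw [sq] at h2
    exact Nat.isUnit_iff.1 (ha d' h2)
  rw [h3, one_mul]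
  exact Dvd.intro_left _ rfl

open ArithmeticFunction in
/-- If `m = b² a` with `a` squarefree, then `d² ∣ m` means `d ∣ b`, so the sum is
`∑_{d ∣ b} μ(d)`. -/
theorem sum_moebius_odd_sq_dvd {m J : ℕ} (hm : Odd m) (hJ : m < (2 * J + 1) ^ 2) :
    (∑ j ∈ Finset.range J, if (2 * j + 1) ^ 2 ∣ m then moebius (2 * j + 1) else 0)
      = if Squarefree m then 1 else 0 := by
  obtain ⟨a, b, ha, hb, rfl, hsq⟩ := Nat.sq_mul_squarefree_of_pos hm.pos
  have hbodd : Odd b := by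
    have := (Nat.odd_mul.1 hm).1
    rw [Nat.odd_pow_iff (by norm_num)] at this
    exact this
  have hbJ : b < 2 * J + 1 := by
    have : b ^ 2 < (2 * J + 1) ^ 2 := lt_of_le_of_lt (Nat.le_mul_of_pos_right _ ha) hJ
    exact lt_of_pow_lt_pow_left₀ 2 (by omega) this
  have h1 : (∑ j ∈ Finset.range J, if (2 * j + 1) ^ 2 ∣ b ^ 2 * a then moebius (2 * j + 1) else 0)
      = ∑ d ∈ b.divisors, moebius d := by
    rw [← Finset.sum_filter]
    refine Finset.sum_bij (fun j _ => 2 * j + 1) ?_ ?_ ?_ ?_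
    · intro j hj
      rw [Finset.mem_filter] at hj
      exact Nat.mem_divisors.2 ⟨Nat.dvd_of_sq_dvd_sq_mul_squarefree hsq hb hj.2, hb.ne'⟩
    · intro i _ j _ h
      simpa using h
    · intro d hd
      have hdb := Nat.dvd_of_mem_divisors hd
      obtain ⟨k, hk⟩ := hbodd.of_dvd_nat hdb
      have := Nat.le_of_dvd hb hdb
      refine ⟨k, Finset.mem_filter.2 ⟨Finset.mem_range.2 (by omega), ?_⟩, hk.symm⟩
      rw [← hk]
      exact Dvd.dvd.mul_right (pow_dvd_pow_of_dvd hdb 2) a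
    · intro j _; rfl
  rw [h1, ← coe_mul_zeta_apply, moebius_mul_coe_zeta, one_apply]
  congr 1
  refine propext ⟨fun h => by simpa [h] using hsq, fun h => ?_⟩
  exact Nat.isUnit_iff.1 (h b (by rw [← sq]; exact Dvd.intro _ rfl))

theorem card_odd_Icc (M : ℕ) : ((Finset.Icc 1 M).filter (fun r => Odd r)).card = (M + 1) / 2 := by
  induction M with
  | zero => simp
  | succ M ih =>
    rw [← Finset.insert_Icc_right_eq_Icc_add_one (by omega), Finset.filter_insert]
    split_ifs with h
    · rw [Finset.card_insert_of_notMem (by simp), ih]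
      obtain ⟨k, hk⟩ := h
      omega
    · rw [ih]
      rw [Nat.not_odd_iff_even] at h
      obtain ⟨k, hk⟩ := h
      omega

theorem card_odd_dvd_Icc {q : ℕ} (hq : Odd q) (N : ℕ) :
    ((Finset.Icc 1 N).filter (fun m => Odd m ∧ q ∣ m)).card = (N / q + 1) / 2 := by
  rw [← card_odd_Icc]
  symm
  refine Finset.card_bij (fun r _ => q * r) ?_ ?_ ?_
  · intro r hr
    simp only [Finset.mem_filter, Finset.mem_Icc] at hr ⊢
    refine ⟨⟨Nat.mul_pos hq.pos hr.1.1, ?_⟩, hq.mul hr.2, Dvd.intro _ rfl⟩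
    exact (Nat.mul_le_mul_left q hr.1.2).trans (Nat.mul_div_le N q)
  · intro r _ s _ h
    exact Nat.eq_of_mul_eq_mul_left hq.pos h
  · intro m hm
    simp only [Finset.mem_filter, Finset.mem_Icc] at hm
    obtain ⟨⟨h1, h2⟩, h3, r, rfl⟩ := hm
    refine ⟨r, ?_, rfl⟩
    simp only [Finset.mem_filter, Finset.mem_Icc]
    refine ⟨⟨Nat.pos_of_mul_pos_left h1, ?_⟩, (Nat.odd_mul.1 h3).2⟩
    rw [Nat.le_div_iff_mul_le hq.pos, mul_comm]
    exact h2

/-- The natural number `(⌊z⌋₊ + 1) / 2` counts the odd numbers in `[1, z]`. -/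
theorem abs_card_odd_sub_le {z : ℝ} (hz : 0 ≤ z) :
    |(((⌊z⌋₊ + 1) / 2 : ℕ) : ℝ) - z / 2| ≤ 1 / 2 := by
  have h1 := Nat.floor_le hz
  have h2 := Nat.lt_floor_add_one z
  rcases Nat.even_or_odd' ⌊z⌋₊ with ⟨k, hk | hk⟩
  · rw [show (⌊z⌋₊ + 1) / 2 = k by omega]
    rw [hk] at h1 h2
    push_cast at h1 h2
    rw [abs_le]; constructor <;> linarith
  · rw [show (⌊z⌋₊ + 1) / 2 = k + 1 by omega]
    rw [hk] at h1 h2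
    push_cast at h1 h2 ⊢
    rw [abs_le]; constructor <;> linarith

/-- By telescoping, since `1 / (2j+1)² ≤ (1/j - 1/(j+1)) / 4`. -/
theorem sum_Ico_one_div_odd_sq_le {J : ℕ} (hJ : 0 < J) (L : ℕ) :
    ∑ j ∈ Finset.range L, 1 / (2 * ((j + J : ℕ) : ℝ) + 1) ^ 2
      ≤ 1 / (4 * (J : ℝ)) - 1 / (4 * ((L + J : ℕ) : ℝ)) := by
  induction L with
  | zero => simp
  | succ L ih =>
    rw [Finset.sum_range_succ]
    have h0 : (0 : ℝ) < ((L + J : ℕ) : ℝ) := by exact_mod_cast (by omega : 0 < L + J)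
    have e : ((L + 1 + J : ℕ) : ℝ) = ((L + J : ℕ) : ℝ) + 1 := by push_cast; ring
    rw [e]
    generalize ((L + J : ℕ) : ℝ) = u at *
    have : 1 / (2 * u + 1) ^ 2 ≤ 1 / (4 * u) - 1 / (4 * (u + 1)) := by
      rw [div_sub_div _ _ (by positivity) (by positivity),
        div_le_div_iff₀ (by positivity) (by positivity)]
      nlinarith
    linarith

open ArithmeticFunction in
theorem abs_moebius_odd_tail_le {J : ℕ} (hJ : 0 < J) :
    |8 / Real.pi ^ 2 - ∑ j ∈ Finset.range J, (moebius (2 * j + 1) : ℝ) / (2 * (j : ℝ) + 1) ^ 2|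
      ≤ 1 / (4 * (J : ℝ)) := by
  have h := hasSum_moebius_odd_div_sq
  have ht := (hasSum_nat_add_iff' J).2 h
  rw [← ht.tsum_eq, ← Real.norm_eq_abs]
  have hlim := ht.tendsto_sum_nat.norm
  rw [← ht.tsum_eq] at hlim
  refine le_of_tendsto hlim (Filter.Eventually.of_forall fun L => ?_)
  refine (norm_sum_le _ _).trans ?_
  have := sum_Ico_one_div_odd_sq_le hJ L
  have h0 : (0 : ℝ) ≤ 1 / (4 * ((L + J : ℕ) : ℝ)) := by positivity
  refine le_trans (Finset.sum_le_sum fun j _ => ?_) (this.trans (by linarith))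
  rw [norm_div, Real.norm_of_nonneg (by positivity : (0:ℝ) ≤ (2 * ((j + J : ℕ) : ℝ) + 1) ^ 2)]
  gcongr
  rw [Real.norm_eq_abs]
  exact_mod_cast abs_moebius_le_one

open ArithmeticFunction in
theorem card_odd_squarefree_eq {N J : ℕ} (hJ : N < (2 * J + 1) ^ 2) :
    ((((Finset.Icc 1 N).filter (fun m => Squarefree m ∧ Odd m)).card : ℤ))
      = ∑ j ∈ Finset.range J, moebius (2 * j + 1) * (((N / (2 * j + 1) ^ 2 + 1) / 2 : ℕ) : ℤ) := by
  have h1 : (((Finset.Icc 1 N).filter (fun m => Squarefree m ∧ Odd m)).card : ℤ)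
      = ∑ m ∈ (Finset.Icc 1 N).filter (fun m => Odd m), if Squarefree m then 1 else 0 := by
    rw [Finset.sum_boole, Finset.filter_filter]
    simp only [and_comm]
  rw [h1]
  have h2 : ∀ m ∈ (Finset.Icc 1 N).filter (fun m => Odd m), (if Squarefree m then (1 : ℤ) else 0)
      = ∑ j ∈ Finset.range J, if (2 * j + 1) ^ 2 ∣ m then moebius (2 * j + 1) else 0 := by
    intro m hm
    rw [Finset.mem_filter, Finset.mem_Icc] at hm
    rw [sum_moebius_odd_sq_dvd hm.2 (lt_of_le_of_lt hm.1.2 hJ)]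
  rw [Finset.sum_congr rfl h2, Finset.sum_comm]
  refine Finset.sum_congr rfl fun j _ => ?_
  rw [← Finset.sum_filter, Finset.sum_const, Finset.filter_filter,
    card_odd_dvd_Icc (by simp : Odd (2 * j + 1)).pow, nsmul_eq_mul, mul_comm]

open ArithmeticFunction in
/-- Rounding costs at most `1/2` for each odd `d ≤ √x`, and the tail of `∑ μ(d)/d²` costs at most
`x/(8J)`. The bound holds down to `x = 0`, which the recursion in `x` below relies on. -/
theorem abs_card_odd_squarefree_sub_le {x : ℝ} (hx : 0 ≤ x) :
    |(((Finset.Icc 1 ⌊x⌋₊).filter (fun m => Squarefree m ∧ Odd m)).card : ℝ) - 4 / Real.pi ^ 2 * x|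
      ≤ 7 / 8 * √x := by
  have hpi : 0 < Real.pi ^ 2 := by positivity
  have hpi9 : 9 < Real.pi ^ 2 := by nlinarith [Real.pi_gt_three]
  have hs := Real.sq_sqrt hx
  have hs0 := Real.sqrt_nonneg x
  rcases lt_or_ge x 1 with h1 | h1
  · rw [Nat.floor_eq_zero.2 h1]
    simp only [zero_lt_one, Finset.Icc_eq_empty_of_lt, Finset.filter_empty, Finset.card_empty,
      Nat.cast_zero, zero_sub, abs_neg]
    rw [abs_of_nonneg (by positivity)]
    have h2 : √x ≤ 1 := Real.sqrt_le_one.2 h1.le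
    have h3 : 4 / Real.pi ^ 2 ≤ 7 / 8 := by
      rw [div_le_div_iff₀ hpi (by norm_num)]; linarith
    have h4 : x ≤ √x := by nlinarith
    exact mul_le_mul h3 h4 hx (by norm_num)
  · -- `J` is the number of odd `d ≤ √x`, so that `2J - 1 ≤ √x < 2J + 1`
    set J := (⌊√x⌋₊ + 1) / 2 with hJdef
    have hs1 : 1 ≤ √x := Real.one_le_sqrt.2 h1
    have hf1 : 1 ≤ ⌊√x⌋₊ := Nat.one_le_floor_iff _ |>.2 hs1
    have hJ0 : 0 < J := by omega
    have hJr : (1 : ℝ) ≤ J := by exact_mod_cast hJ0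
    have hJlo : 2 * (J : ℝ) - 1 ≤ √x := by
      have : 2 * J ≤ ⌊√x⌋₊ + 1 := by omega
      have : (2 : ℝ) * J ≤ ⌊√x⌋₊ + 1 := by exact_mod_cast this
      linarith [Nat.floor_le hs0]
    have hJhi : √x < 2 * (J : ℝ) + 1 := by
      have h : ⌊√x⌋₊ + 1 ≤ 2 * J + 1 := by omega
      have h' : (⌊√x⌋₊ : ℝ) + 1 ≤ 2 * J + 1 := by exact_mod_cast h
      linarith [Nat.lt_floor_add_one √x]
    have hN : ⌊x⌋₊ < (2 * J + 1) ^ 2 := by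
      rw [Nat.floor_lt hx]
      push_cast
      nlinarith
    have hcard := congrArg (fun z : ℤ => (z : ℝ)) (card_odd_squarefree_eq hN)
    simp only [Int.cast_natCast, Int.cast_sum, Int.cast_mul] at hcard
    rw [hcard]
    have htail := abs_moebius_odd_tail_le hJ0
    set D := ∑ j ∈ Finset.range J, (moebius (2 * j + 1) : ℝ) / (2 * (j : ℝ) + 1) ^ 2 with hD
    have hmain : |∑ j ∈ Finset.range J, (moebius (2 * j + 1) : ℝ) *
        (((⌊x⌋₊ / (2 * j + 1) ^ 2 + 1) / 2 : ℕ) : ℝ) - D * x / 2| ≤ J * (1 / 2) := by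
      rw [hD, Finset.sum_mul, Finset.sum_div, ← Finset.sum_sub_distrib]
      refine (Finset.abs_sum_le_sum_abs _ _).trans ?_
      rw [← nsmul_eq_mul, ← Finset.card_range J, Finset.card_range]
      refine (Finset.sum_le_card_nsmul (Finset.range J) _ (1 / 2) fun j _ => ?_).trans
        (by rw [Finset.card_range])
      have hz : (0 : ℝ) ≤ x / ((2 * j + 1) ^ 2 : ℕ) := by positivity
      have hb := abs_card_odd_sub_le hz
      rw [Nat.floor_div_natCast] at hb
      have hmu : |(moebius (2 * j + 1) : ℝ)| ≤ 1 := by exact_mod_cast abs_moebius_le_one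
      have e : (moebius (2 * j + 1) : ℝ) * (((⌊x⌋₊ / (2 * j + 1) ^ 2 + 1) / 2 : ℕ) : ℝ)
          - (moebius (2 * j + 1) : ℝ) / (2 * (j : ℝ) + 1) ^ 2 * x / 2
          = (moebius (2 * j + 1) : ℝ) * ((((⌊x⌋₊ / (2 * j + 1) ^ 2 + 1) / 2 : ℕ) : ℝ)
            - x / ((2 * j + 1) ^ 2 : ℕ) / 2) := by
        push_cast; ring
      rw [e, abs_mul]
      calc _ ≤ 1 * (1 / 2 : ℝ) := mul_le_mul hmu hb (abs_nonneg _) zero_le_one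
        _ = _ := one_mul _
    have htail2 : |D * x / 2 - 4 / Real.pi ^ 2 * x| ≤ 3 / 8 * √x := by
      have e : D * x / 2 - 4 / Real.pi ^ 2 * x = -((8 / Real.pi ^ 2 - D) * (x / 2)) := by ring
      rw [e, abs_neg, abs_mul, abs_of_nonneg (by positivity : 0 ≤ x / 2)]
      calc _ ≤ 1 / (4 * (J : ℝ)) * (x / 2) := mul_le_mul_of_nonneg_right htail (by positivity)
        _ = x / (8 * J) := by field_simp; norm_num
        _ ≤ _ := by
          rw [div_le_iff₀ (by positivity)]
          have : x ≤ √x * (3 * J) := by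
            nlinarith
          linarith
    have hJs : (J : ℝ) * (1 / 2) ≤ 1 / 2 * √x := by linarith
    calc _ ≤ _ := abs_sub_le _ (D * x / 2) _
      _ ≤ _ := add_le_add hmain htail2
      _ ≤ _ := by linarith

/-! ### Odd squarefree numbers avoiding a set of primes -/

/-- The odd squarefree numbers in `[1, x]` that are divisible by no element of `P`. -/
noncomputable def oddSquarefreeAvoiding (P : Finset ℕ) (x : ℝ) : Finset ℕ :=
  (Finset.Icc 1 ⌊x⌋₊).filter (fun m => (Squarefree m ∧ Odd m) ∧ ∀ p ∈ P, ¬ p ∣ m)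

/-- The multiples of `p` counted on the left are `p * m` with `m ≤ x / p` not divisible by `p`. -/
theorem card_oddSquarefreeAvoiding_insert {P : Finset ℕ} {p : ℕ} (hp : p.Prime) (hp2 : p ≠ 2)
    (hP : ∀ q ∈ P, q.Prime) (hpP : p ∉ P) (x : ℝ) :
    (oddSquarefreeAvoiding P x).card = (oddSquarefreeAvoiding (insert p P) x).card
      + (oddSquarefreeAvoiding (insert p P) (x / p)).card := by
  have hpodd : Odd p := hp.odd_of_ne_two hp2
  rw [← Finset.card_filter_add_card_filter_not (s := oddSquarefreeAvoiding P x) (fun m => ¬ p ∣ m)]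
  congr 1
  · congr 1
    ext m
    simp only [oddSquarefreeAvoiding, Finset.mem_filter, Finset.forall_mem_insert]
    tauto
  · symm
    refine Finset.card_bij (fun m _ => p * m) ?_ ?_ ?_
    · intro m hm
      simp only [oddSquarefreeAvoiding, Finset.mem_filter, Finset.forall_mem_insert,
        Finset.mem_Icc, Nat.floor_div_natCast] at hm ⊢
      obtain ⟨⟨h1, h2⟩, ⟨h3, h4⟩, h5, h6⟩ := hm
      refine ⟨⟨⟨Nat.mul_pos hp.pos h1, ?_⟩, ⟨?_, hpodd.mul h4⟩, ?_⟩, ?_⟩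
      · exact (Nat.mul_le_mul_left p h2).trans (Nat.mul_div_le _ p)
      · exact (Nat.squarefree_mul ((Nat.Prime.coprime_iff_not_dvd hp).2 h5)).2 ⟨hp.squarefree, h3⟩
      · intro q hq hd
        rcases (hP q hq).dvd_mul.1 hd with h | h
        · rw [Nat.prime_dvd_prime_iff_eq (hP q hq) hp] at h
          exact hpP (h ▸ hq)
        · exact h6 q hq h
      · exact not_not.2 (Dvd.intro _ rfl)
    · intro a _ b _ h
      exact Nat.eq_of_mul_eq_mul_left hp.pos h
    · intro m hm
      simp only [oddSquarefreeAvoiding, Finset.mem_filter, Finset.mem_Icc, not_not] at hm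
      obtain ⟨⟨⟨h1, h2⟩, ⟨h3, h4⟩, h5⟩, r, rfl⟩ := hm
      refine ⟨r, ?_, rfl⟩
      simp only [oddSquarefreeAvoiding, Finset.mem_filter, Finset.forall_mem_insert,
        Finset.mem_Icc, Nat.floor_div_natCast]
      refine ⟨⟨Nat.pos_of_mul_pos_left h1, ?_⟩, ⟨h3.of_mul_right, (Nat.odd_mul.1 h4).2⟩, ?_, ?_⟩
      · rw [Nat.le_div_iff_mul_le hp.pos, mul_comm]
        exact h2
      · intro hd
        have := (Nat.squarefree_mul_iff.1 h3).1
        exact (Nat.Prime.coprime_iff_not_dvd hp).1 this hd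
      · intro q hq hd
        exact h5 q hq (hd.mul_left p)

/-- The relative density, among the odd squarefree numbers, of those divisible by no prime
of `P`. -/
noncomputable def avoidingDensity (P : Finset ℕ) : ℝ := ∏ p ∈ P, (p : ℝ) / (p + 1)

/-- The factor by which excluding the multiples of the primes of `P` enlarges the error term of the
count of odd squarefree numbers. -/
noncomputable def errorFactor (P : Finset ℕ) : ℝ := ∏ p ∈ P, 1 / (1 - 1 / √(p : ℝ))

theorem avoidingDensity_pos {P : Finset ℕ} (hP : ∀ p ∈ P, p.Prime) : 0 < avoidingDensity P :=
  Finset.prod_pos fun p hp => by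
    have : (0 : ℝ) < p := by exact_mod_cast (hP p hp).pos
    positivity

theorem avoidingDensity_le_one (P : Finset ℕ) : avoidingDensity P ≤ 1 :=
  Finset.prod_le_one (fun p _ => by positivity) fun p _ => by
    rw [div_le_one (by positivity)]; linarith

theorem one_lt_sqrt_prime {p : ℕ} (hp : p.Prime) : 1 < √(p : ℝ) := by
  rw [Real.lt_sqrt zero_le_one]
  have : (2 : ℝ) ≤ p := by exact_mod_cast hp.two_le
  linarith

theorem one_sub_inv_sqrt_pos {p : ℕ} (hp : p.Prime) : 0 < 1 - 1 / √(p : ℝ) := by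
  have := one_lt_sqrt_prime hp
  rw [sub_pos, div_lt_one (by linarith)]
  exact this

theorem one_le_errorFactor {P : Finset ℕ} (hP : ∀ p ∈ P, p.Prime) : 1 ≤ errorFactor P := by
  refine Finset.one_le_prod fun p hp => ?_
  rw [one_le_div (one_sub_inv_sqrt_pos (hP p hp))]
  have : 0 < 1 / √(p : ℝ) := by have := one_lt_sqrt_prime (hP p hp); positivity
  linarith

/-- In the relation `A(x) = A'(x) + A'(x/p)` between the counts before and after excluding `p`, an
error `C √x` for `A` gives an error `C' √x` for `A'` as soon as `C + C'/√p = C'`. -/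
theorem abs_card_oddSquarefreeAvoiding_sub_le {P : Finset ℕ} (hP : ∀ p ∈ P, p.Prime ∧ p ≠ 2)
    {x : ℝ} (hx : 0 ≤ x) :
    |((oddSquarefreeAvoiding P x).card : ℝ) - 4 / Real.pi ^ 2 * avoidingDensity P * x|
      ≤ 7 / 8 * errorFactor P * √x := by
  induction P using Finset.induction_on generalizing x with
  | empty =>
    have := abs_card_odd_squarefree_sub_le hx
    simpa [oddSquarefreeAvoiding, avoidingDensity, errorFactor] using this
  | insert p P hpP ih =>
    have ih := fun {x : ℝ} (hx : 0 ≤ x) => ih (fun q hq => hP q (Finset.mem_insert_of_mem hq)) hx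
    obtain ⟨hp, hp2⟩ := hP p (Finset.mem_insert_self p P)
    have hprime : ∀ q ∈ P, q.Prime := fun q hq => (hP q (Finset.mem_insert_of_mem hq)).1
    have hprime' : ∀ q ∈ insert p P, q.Prime := fun q hq => (hP q hq).1
    have hp0 : (0 : ℝ) < p := by exact_mod_cast hp.pos
    have hp2' : (2 : ℝ) ≤ p := by exact_mod_cast hp.two_le
    have hs := one_lt_sqrt_prime hp
    have hs' := one_sub_inv_sqrt_pos hp
    -- induction on a bound `2 ^ k` for `x`: the set is empty once `x < 1`, and `x / p ≤ x / 2`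
    suffices H : ∀ k : ℕ, ∀ x : ℝ, 0 ≤ x → x < 2 ^ k →
        |((oddSquarefreeAvoiding (insert p P) x).card : ℝ)
          - 4 / Real.pi ^ 2 * avoidingDensity (insert p P) * x|
          ≤ 7 / 8 * errorFactor (insert p P) * √x by
      obtain ⟨k, hk⟩ := pow_unbounded_of_one_lt x (one_lt_two : (1 : ℝ) < 2)
      exact H k x hx hk
    intro k
    induction k with
    | zero =>
      intro x hx hx1
      rw [pow_zero] at hx1
      have : (oddSquarefreeAvoiding (insert p P) x).card = 0 := by
        rw [oddSquarefreeAvoiding, Nat.floor_eq_zero.2 hx1]; simp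
      have hd0 := avoidingDensity_pos hprime'
      have hd1 := avoidingDensity_le_one (insert p P)
      have hG := one_le_errorFactor hprime'
      rw [this, Nat.cast_zero, zero_sub, abs_neg, abs_of_nonneg (by positivity)]
      have h2 : √x ≤ 1 := Real.sqrt_le_one.2 hx1.le
      have h3 : 4 / Real.pi ^ 2 ≤ 7 / 8 := by
        rw [div_le_div_iff₀ (by positivity) (by norm_num)]; nlinarith [Real.pi_gt_three]
      have h4 : x ≤ √x := by nlinarith [Real.sq_sqrt hx, Real.sqrt_nonneg x]
      refine mul_le_mul (mul_le_mul h3 (hd1.trans hG) hd0.le (by norm_num)) h4 hx (by positivity)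
    | succ k ihk =>
      intro x hx hxk
      have hxp : x / p < 2 ^ k := by
        rw [div_lt_iff₀ hp0]
        calc x < 2 ^ k * 2 := by rw [← pow_succ]; exact hxk
          _ ≤ _ := by gcongr
      have h1 := ihk (x / p) (by positivity) hxp
      have h2 := ih hx
      have hrec := card_oddSquarefreeAvoiding_insert hp hp2 hprime hpP x
      have hrec' : ((oddSquarefreeAvoiding P x).card : ℝ)
          = (oddSquarefreeAvoiding (insert p P) x).card
            + (oddSquarefreeAvoiding (insert p P) (x / p)).card := by exact_mod_cast hrec
      have hf : avoidingDensity P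
          = avoidingDensity (insert p P) + avoidingDensity (insert p P) / p := by
        rw [avoidingDensity, avoidingDensity, Finset.prod_insert hpP]
        field_simp
      have hG : errorFactor P = errorFactor (insert p P) - errorFactor (insert p P) / √p := by
        rw [errorFactor, errorFactor, Finset.prod_insert hpP]
        generalize ∏ x ∈ P, 1 / (1 - 1 / √(x : ℝ)) = Q
        calc Q = (1 / (1 - 1 / √(p : ℝ)) * (1 - 1 / √(p : ℝ))) * Q := by
              rw [one_div_mul_cancel hs'.ne', one_mul]
          _ = _ := by ring
      rw [Real.sqrt_div hx] at h1
      rw [hrec', hf, hG] at h2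
      have key : ((oddSquarefreeAvoiding (insert p P) x).card : ℝ)
          - 4 / Real.pi ^ 2 * avoidingDensity (insert p P) * x
          = (((oddSquarefreeAvoiding (insert p P) x).card : ℝ)
              + (oddSquarefreeAvoiding (insert p P) (x / p)).card
              - 4 / Real.pi ^ 2 * (avoidingDensity (insert p P)
                + avoidingDensity (insert p P) / p) * x)
            - (((oddSquarefreeAvoiding (insert p P) (x / p)).card : ℝ)
              - 4 / Real.pi ^ 2 * avoidingDensity (insert p P) * (x / p)) := by
        ring
      rw [key]
      refine (abs_sub _ _).trans ((add_le_add h2 h1).trans (le_of_eq ?_))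
      field_simp
      ring

/-! ### The size of the error factor -/

theorem errorFactor_eq {P : Finset ℕ} (hP : ∀ p ∈ P, p.Prime) :
    errorFactor P = (∏ p ∈ P, (1 + 1 / (p : ℝ)) / (1 - 1 / √(p : ℝ))) * avoidingDensity P := by
  rw [errorFactor, avoidingDensity, ← Finset.prod_mul_distrib]
  refine Finset.prod_congr rfl fun p hp => ?_
  have hp0 : (0 : ℝ) < p := by exact_mod_cast (hP p hp).pos
  have := (one_sub_inv_sqrt_pos (hP p hp)).ne'
  generalize 1 - 1 / √(p : ℝ) = u at *
  field_simp

theorem one_add_inv_div_one_sub_inv_sqrt_le {p s r : ℝ} (hs : 1 < s) (hsp : s ^ 2 ≤ p)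
    (hr : 1 + 1 / s ^ 2 ≤ r * (1 - 1 / s)) : (1 + 1 / p) / (1 - 1 / √p) ≤ r := by
  have hs0 : 0 < s := by linarith
  have hsq : s ≤ √p := Real.le_sqrt_of_sq_le hsp
  have h1 : 1 / √p ≤ 1 / s := one_div_le_one_div_of_le hs0 hsq
  have h2 : 1 / p ≤ 1 / s ^ 2 := one_div_le_one_div_of_le (by positivity) hsp
  have h3 : 0 < 1 - 1 / s := by rw [sub_pos, div_lt_one hs0]; exact hs
  have hr0 : 0 ≤ r := by
    by_contra h
    have : r * (1 - 1 / s) < 0 := mul_neg_of_neg_of_pos (not_le.1 h) h3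
    have : 0 < 1 / s ^ 2 := by positivity
    linarith
  rw [div_le_iff₀ (by linarith)]
  nlinarith

/-- `localConstant p` is at least `h(p) ^ 10 / p`, where `h(p) = (1 + 1/p) / (1 - 1/√p)`: it exceeds
`1` only at the primes from `3` to `19`, where the decimals are upper bounds of `h(p)`. -/
noncomputable def localConstant (p : ℕ) : ℝ :=
  if p = 3 then 3.155 ^ 10 / 3 else if p = 5 then 2.171 ^ 10 / 5 else
  if p = 7 then 1.838 ^ 10 / 7 else if p = 11 then 1.562 ^ 10 / 11 else
  if p = 13 then 1.491 ^ 10 / 13 else if p = 17 then 1.398 ^ 10 / 17 else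
  if p = 19 then 1.367 ^ 10 / 19 else 1

theorem one_le_localConstant (p : ℕ) : 1 ≤ localConstant p := by
  unfold localConstant
  split_ifs <;> norm_num

/-- In the applications of `aux` below, `s` is a lower bound of `√p`. -/
theorem pow_ten_le_localConstant_mul {p : ℕ} (hp : p.Prime) (hp2 : p ≠ 2) :
    ((1 + 1 / (p : ℝ)) / (1 - 1 / √(p : ℝ))) ^ 10 ≤ localConstant p * p := by
  have h0 : 0 ≤ (1 + 1 / (p : ℝ)) / (1 - 1 / √(p : ℝ)) :=
    div_nonneg (by positivity) (one_sub_inv_sqrt_pos hp).le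
  have aux : ∀ {s r : ℝ}, 1 < s → s ^ 2 ≤ p → 1 + 1 / s ^ 2 ≤ r * (1 - 1 / s) →
      ((1 + 1 / (p : ℝ)) / (1 - 1 / √(p : ℝ))) ^ 10 ≤ r ^ 10 := fun hs hsp hr =>
    pow_le_pow_left₀ h0 (one_add_inv_div_one_sub_inv_sqrt_le hs hsp hr) 10
  by_cases h23 : 23 ≤ p
  · -- `h(p) ≤ h(23) < 1.33` and `1.33 ^ 10 < 23 ≤ p`
    have h : (23 : ℝ) ≤ p := by exact_mod_cast h23
    have h1 := aux (s := 4.79) (r := 1.33) (by norm_num) (by norm_num; linarith) (by norm_num)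
    have h2 : localConstant p = 1 := by
      unfold localConstant
      simp only [show p ≠ 3 by omega, show p ≠ 5 by omega, show p ≠ 7 by omega,
        show p ≠ 11 by omega, show p ≠ 13 by omega, show p ≠ 17 by omega, show p ≠ 19 by omega,
        if_false]
    rw [h2, one_mul]
    refine h1.trans (le_trans ?_ h)
    norm_num
  · have h3 : p < 23 := not_le.1 h23
    interval_cases p <;>
      first | (exfalso; revert hp; norm_num; done) | (exact absurd rfl hp2) | skip
    · exact (aux (s := 1.732) (r := 3.155) (by norm_num) (by norm_num) (by norm_num)).trans
        (by norm_num [localConstant])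
    · exact (aux (s := 2.236) (r := 2.171) (by norm_num) (by norm_num) (by norm_num)).trans
        (by norm_num [localConstant])
    · exact (aux (s := 2.6457) (r := 1.838) (by norm_num) (by norm_num) (by norm_num)).trans
        (by norm_num [localConstant])
    · exact (aux (s := 3.3166) (r := 1.562) (by norm_num) (by norm_num) (by norm_num)).trans
        (by norm_num [localConstant])
    · exact (aux (s := 3.6055) (r := 1.491) (by norm_num) (by norm_num) (by norm_num)).trans
        (by norm_num [localConstant])
    · exact (aux (s := 4.1231) (r := 1.398) (by norm_num) (by norm_num) (by norm_num)).trans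
        (by norm_num [localConstant])
    · exact (aux (s := 4.3588) (r := 1.367) (by norm_num) (by norm_num) (by norm_num)).trans
        (by norm_num [localConstant])

theorem prod_localConstant_le (P : Finset ℕ) : ∏ p ∈ P, localConstant p ≤ 12.2 ^ 10 := by
  set S : Finset ℕ := {3, 5, 7, 11, 13, 17, 19} with hS
  have h1 : ∏ p ∈ P, localConstant p ≤ ∏ p ∈ P ∪ S, localConstant p :=
    Finset.prod_le_prod_of_subset_of_one_le Finset.subset_union_left
      (fun p _ => zero_le_one.trans (one_le_localConstant p)) fun p _ _ => one_le_localConstant p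
  have h2 : ∏ p ∈ S, localConstant p = ∏ p ∈ P ∪ S, localConstant p := by
    refine Finset.prod_subset Finset.subset_union_right fun p _ hp => ?_
    simp only [hS, Finset.mem_insert, Finset.mem_singleton, not_or] at hp
    simp [localConstant, hp]
  rw [← h2] at h1
  refine h1.trans ?_
  rw [hS]
  norm_num [localConstant]

/-- With `H = errorFactor / avoidingDensity`, this is `H ≤ 12.2 n^{1/10}` combined with
`n^{2/5} ≥ 10^4`. -/
theorem errorFactor_primeFactors_le {n l : ℕ} (hn : 10 ^ 10 ≤ n) (hl0 : l ≠ 0) (hl : l ≤ n)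
    (hodd : Odd l) :
    errorFactor l.primeFactors ≤ 0.00122 * √(n : ℝ) * avoidingDensity l.primeFactors := by
  have hP : ∀ p ∈ l.primeFactors, p.Prime := fun p hp => Nat.prime_of_mem_primeFactors hp
  have hP2 : ∀ p ∈ l.primeFactors, p ≠ 2 := by
    rintro p hp rfl
    exact (Nat.not_even_iff_odd.2 hodd) (even_iff_two_dvd.2 (Nat.dvd_of_mem_primeFactors hp))
  rw [errorFactor_eq hP]
  refine mul_le_mul_of_nonneg_right ?_ (avoidingDensity_pos hP).le
  refine le_of_pow_le_pow_left₀ (n := 10) (by norm_num) (by positivity) ?_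
  have hnr : (10 : ℝ) ^ 10 ≤ n := by exact_mod_cast hn
  rw [← Finset.prod_pow]
  calc ∏ p ∈ l.primeFactors, ((1 + 1 / (p : ℝ)) / (1 - 1 / √(p : ℝ))) ^ 10
      ≤ ∏ p ∈ l.primeFactors, localConstant p * p :=
        Finset.prod_le_prod (fun p _ => by positivity)
          fun p hp => pow_ten_le_localConstant_mul (hP p hp) (hP2 p hp)
    _ = (∏ p ∈ l.primeFactors, localConstant p) * ∏ p ∈ l.primeFactors, (p : ℝ) :=
        Finset.prod_mul_distrib
    _ ≤ (12.2 ^ 10) * n := by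
        refine mul_le_mul (prod_localConstant_le _) ?_ (by positivity) (by positivity)
        have : ∏ p ∈ l.primeFactors, p ≤ n :=
          (Nat.le_of_dvd (Nat.pos_of_ne_zero hl0) (Nat.prod_primeFactors_dvd l)).trans hl
        rw [← Nat.cast_prod]
        exact_mod_cast this
    _ = 0.00122 ^ 10 * ((10 ^ 10) ^ 4 * n) := by norm_num; ring
    _ ≤ 0.00122 ^ 10 * ((n : ℝ) ^ 4 * n) := by gcongr
    _ = (0.00122 * √(n : ℝ)) ^ 10 := by
        rw [mul_pow, show (10 : ℕ) = 2 * 5 by norm_num, pow_mul (√(n : ℝ)),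
          Real.sq_sqrt (by positivity)]
        ring

/-! ### The number of vertices coprime to a given vertex -/

theorem forall_primeFactors_not_dvd_iff_coprime {l m : ℕ} (hl : l ≠ 0) :
    (∀ p ∈ l.primeFactors, ¬ p ∣ m) ↔ Nat.Coprime l m := by
  constructor
  · intro h
    refine Nat.Coprime.symm (Nat.coprime_of_dvd fun p hp hm hpl => ?_)
    exact h p (Nat.mem_primeFactors.2 ⟨hp, hpl, hl⟩) hm
  · intro h p hp hm
    have hd := Nat.dvd_gcd (Nat.dvd_of_mem_primeFactors hp) hm
    rw [h.gcd_eq_one] at hd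
    exact (Nat.prime_of_mem_primeFactors hp).one_lt.ne' (Nat.dvd_one.1 hd)

/-- Halving identifies the even vertices with the odd squarefree numbers up to `n / 2`. -/
theorem evenCoprimeCount_eq {l : ℕ} (hl : Odd l) (n : ℕ) :
    evenCoprimeCount l n = (oddSquarefreeAvoiding l.primeFactors ((n : ℝ) / 2)).card := by
  have hl0 : l ≠ 0 := hl.pos.ne'
  have hfloor : ⌊(n : ℝ) / 2⌋₊ = n / 2 := by
    have h := Nat.floor_div_natCast (n : ℝ) 2
    rw [Nat.floor_natCast] at h
    exact_mod_cast h
  unfold evenCoprimeCount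
  symm
  refine Finset.card_bij (fun m _ => 2 * m) ?_ ?_ ?_
  · intro m hm
    simp only [oddSquarefreeAvoiding, evenVertices, vertices, Finset.mem_filter, Finset.mem_Icc,
      hfloor, forall_primeFactors_not_dvd_iff_coprime hl0] at hm ⊢
    obtain ⟨⟨h1, h2⟩, ⟨h3, h4⟩, h5⟩ := hm
    refine ⟨⟨⟨⟨by omega, by omega⟩, ?_⟩, even_two_mul m⟩, ?_⟩
    · exact (Nat.squarefree_mul (Nat.coprime_two_left.2 h4)).2 ⟨Nat.prime_two.squarefree, h3⟩
    · exact Nat.Coprime.mul_right (Nat.coprime_two_right.2 hl) h5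
  · intro a _ b _ h
    exact Nat.eq_of_mul_eq_mul_left two_pos h
  · intro b hb
    simp only [evenVertices, vertices, Finset.mem_filter, Finset.mem_Icc] at hb
    obtain ⟨⟨⟨⟨h1, h2⟩, h3⟩, h4⟩, h5⟩ := hb
    obtain ⟨m, rfl⟩ := even_iff_two_dvd.1 h4
    refine ⟨m, ?_, rfl⟩
    simp only [oddSquarefreeAvoiding, Finset.mem_filter, Finset.mem_Icc,
      hfloor, forall_primeFactors_not_dvd_iff_coprime hl0]
    have hc := (Nat.squarefree_mul_iff.1 h3).1
    exact ⟨⟨by omega, by omega⟩, ⟨h3.of_mul_right, Nat.coprime_two_left.1 hc⟩,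
      h5.coprime_mul_left_right⟩

theorem oddSharingCount_add_card {l : ℕ} (hl : l ≠ 0) (n : ℕ) :
    oddSharingCount l n + (oddSquarefreeAvoiding l.primeFactors (n : ℝ)).card
      = (oddSquarefreeAvoiding ∅ (n : ℝ)).card := by
  have h1 : oddSquarefreeAvoiding ∅ (n : ℝ) = oddVertices n := by
    ext m
    simp [oddSquarefreeAvoiding, oddVertices, vertices, and_assoc]
  have h2 : oddSquarefreeAvoiding l.primeFactors (n : ℝ)
      = (oddVertices n).filter (fun m => Nat.Coprime l m) := by
    ext m
    simp only [oddSquarefreeAvoiding, oddVertices, vertices, Finset.mem_filter, Finset.mem_Icc,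
      Nat.floor_natCast, forall_primeFactors_not_dvd_iff_coprime hl]
    tauto
  rw [h1, h2, oddSharingCount, add_comm]
  exact Finset.card_filter_add_card_filter_not _

theorem primeFactors_prime_and_ne_two {l : ℕ} (hl : Odd l) :
    ∀ p ∈ l.primeFactors, p.Prime ∧ p ≠ 2 := by
  refine fun p hp => ⟨Nat.prime_of_mem_primeFactors hp, ?_⟩
  rintro rfl
  exact (Nat.not_even_iff_odd.2 hl) (even_iff_two_dvd.2 (Nat.dvd_of_mem_primeFactors hp))

/-- The constant is `7/8 · 0.00122`. -/
theorem abs_card_coprime_sub_le {n l : ℕ} (hn : 10 ^ 10 ≤ n) (hl : l ≤ n) (hodd : Odd l) :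
    |((oddSquarefreeAvoiding l.primeFactors (n : ℝ)).card : ℝ)
        - 4 / Real.pi ^ 2 * avoidingDensity l.primeFactors * n|
      ≤ 0.0010675 * avoidingDensity l.primeFactors * n := by
  have h := abs_card_oddSquarefreeAvoiding_sub_le (primeFactors_prime_and_ne_two hodd)
    (Nat.cast_nonneg (α := ℝ) n)
  refine h.trans ?_
  have hG := errorFactor_primeFactors_le hn hodd.pos.ne' hl hodd
  have hs := Real.mul_self_sqrt (Nat.cast_nonneg (α := ℝ) n)
  calc _ ≤ 7 / 8 * (0.00122 * √(n : ℝ) * avoidingDensity l.primeFactors) * √(n : ℝ) := by gcongr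
    _ = 0.0010675 * avoidingDensity l.primeFactors * (√(n : ℝ) * √(n : ℝ)) := by ring
    _ = _ := by rw [hs]

/-- The constant is `7/8 · 0.00122 / √2`, rounded up. -/
theorem abs_evenCoprimeCount_sub_le {n l : ℕ} (hn : 10 ^ 10 ≤ n) (hl : l ≤ n) (hodd : Odd l) :
    |(evenCoprimeCount l n : ℝ) - 2 / Real.pi ^ 2 * avoidingDensity l.primeFactors * n|
      ≤ 0.000755 * avoidingDensity l.primeFactors * n := by
  have h := abs_card_oddSquarefreeAvoiding_sub_le (primeFactors_prime_and_ne_two hodd)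
    (by positivity : (0 : ℝ) ≤ (n : ℝ) / 2)
  rw [← evenCoprimeCount_eq hodd] at h
  have hf := (avoidingDensity_pos fun p hp => (primeFactors_prime_and_ne_two hodd p hp).1).le
  have hG := errorFactor_primeFactors_le hn hodd.pos.ne' hl hodd
  have hs := Real.mul_self_sqrt (Nat.cast_nonneg (α := ℝ) n)
  have hhalf : √((n : ℝ) / 2) ≤ 0.7072 * √(n : ℝ) := by
    rw [Real.sqrt_le_left (by positivity), mul_pow, Real.sq_sqrt (by positivity)]
    have : (0 : ℝ) ≤ n := Nat.cast_nonneg n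
    norm_num
    linarith
  calc _ = |(evenCoprimeCount l n : ℝ)
        - 4 / Real.pi ^ 2 * avoidingDensity l.primeFactors * ((n : ℝ) / 2)| := by
        congr 1; ring
    _ ≤ _ := h
    _ ≤ 7 / 8 * (0.00122 * √(n : ℝ) * avoidingDensity l.primeFactors) * (0.7072 * √(n : ℝ)) := by
        gcongr
    _ = 0.0010675 * 0.7072 * avoidingDensity l.primeFactors * (√(n : ℝ) * √(n : ℝ)) := by ring
    _ ≤ 0.000755 * avoidingDensity l.primeFactors * (√(n : ℝ) * √(n : ℝ)) := by
        gcongr; norm_num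
    _ = _ := by rw [hs]

theorem sqrt_le_of_ten_pow_le {n : ℕ} (hn : 10 ^ 10 ≤ n) : √(n : ℝ) ≤ 0.00001 * n := by
  have hnr : (10 : ℝ) ^ 10 ≤ n := by exact_mod_cast hn
  rw [Real.sqrt_le_left (by positivity)]
  nlinarith

theorem oddSharingCount_le_evenCoprimeCount {n l : ℕ} (hn : 10 ^ 10 ≤ n) (hl : l ≤ n)
    (hodd : Odd l) (hK : threshold n < evenCoprimeCount l n) :
    oddSharingCount l n ≤ evenCoprimeCount l n := by
  have hnr : (10 : ℝ) ^ 10 ≤ n := by exact_mod_cast hn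
  have hsum : (oddSharingCount l n : ℝ) + (oddSquarefreeAvoiding l.primeFactors (n : ℝ)).card
      = (oddSquarefreeAvoiding ∅ (n : ℝ)).card := by
    exact_mod_cast oddSharingCount_add_card hodd.pos.ne' n
  have hall := abs_card_oddSquarefreeAvoiding_sub_le (P := ∅) (by simp)
    (Nat.cast_nonneg (α := ℝ) n)
  rw [avoidingDensity, errorFactor, Finset.prod_empty, Finset.prod_empty] at hall
  have hcop := abs_card_coprime_sub_le hn hl hodd
  have heven := abs_evenCoprimeCount_sub_le hn hl hodd
  have hsqrt := sqrt_le_of_ten_pow_le hn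
  have hf1 := avoidingDensity_le_one l.primeFactors
  have hfn : avoidingDensity l.primeFactors * n ≤ n := by nlinarith
  rw [abs_le] at hall hcop heven
  -- the error terms must fit into `3 K(n) - (4 / π²) n = 0.016 · (2 / π²) n`
  have hpi : 0.2026 ≤ 2 / Real.pi ^ 2 := by
    rw [le_div_iff₀ (by positivity)]
    nlinarith [Real.pi_lt_d4, Real.pi_gt_three]
  have hpin : 0.2026 * (n : ℝ) ≤ 2 / Real.pi ^ 2 * n := by gcongr
  have hK' : 0.672 * (2 / Real.pi ^ 2 * n) < evenCoprimeCount l n := by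
    refine lt_of_eq_of_lt ?_ hK
    rw [threshold]; ring
  have e1 : 4 / Real.pi ^ 2 * avoidingDensity l.primeFactors * n
      = 2 * (2 / Real.pi ^ 2 * avoidingDensity l.primeFactors * n) := by ring
  have e2 : 4 / Real.pi ^ 2 * 1 * (n : ℝ) = 2 * (2 / Real.pi ^ 2 * n) := by ring
  rw [e1] at hcop
  rw [e2] at hall
  have : (oddSharingCount l n : ℝ) ≤ evenCoprimeCount l n := by
    linarith [hall.2, hcop.1, heven.2]
  exact_mod_cast this

/-! ### Vertices coprime to few even vertices -/

/-- The function `d ↦ 1/d`, restricted to the numbers coprime to `30`. -/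
noncomputable def invCoprimeThirty : ArithmeticFunction ℝ where
  toFun d := if Nat.Coprime 30 d then (d : ℝ)⁻¹ else 0
  map_zero' := by simp

theorem invCoprimeThirty_apply (d : ℕ) :
    invCoprimeThirty d = if Nat.Coprime 30 d then (d : ℝ)⁻¹ else 0 := rfl

theorem isMultiplicative_invCoprimeThirty : invCoprimeThirty.IsMultiplicative := by
  refine ⟨by simp [invCoprimeThirty_apply], fun {m n} _ => ?_⟩
  simp only [invCoprimeThirty_apply, Nat.coprime_mul_iff_right]
  rw [ite_zero_mul_ite_zero, Nat.cast_mul, mul_inv]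

/-- `∏ (1 + 1/p)` over the primes `p ∣ l` other than `2, 3, 5`, when `l` is squarefree. -/
noncomputable def sumInvCoprimeThirty (l : ℕ) : ℝ := ∑ d ∈ l.divisors, invCoprimeThirty d

/-- `∏ (1 + 1/p)` over the primes `p ∈ {3, 5}` that divide `a`. -/
noncomputable def smallFactor (a : ℕ) : ℝ :=
  (if 3 ∣ a then 4 / 3 else 1) * if 5 ∣ a then 6 / 5 else 1

theorem inv_avoidingDensity_eq {l : ℕ} (hsq : Squarefree l) (hodd : Odd l) :
    (avoidingDensity l.primeFactors)⁻¹ = smallFactor (l.gcd 15) * sumInvCoprimeThirty l := by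
  have hite : ∀ q : ℕ, q.Prime → q ∣ 15 → ∀ r : ℝ,
      (∏ p ∈ l.primeFactors, if p = q then r else 1) = if q ∣ l.gcd 15 then r else 1 := by
    intro q hq hq15 r
    rw [Finset.prod_ite_eq' l.primeFactors q fun _ => r]
    simp [Nat.dvd_gcd_iff, hq, hq15, hsq.ne_zero]
  rw [smallFactor, ← hite 3 (by norm_num) (by norm_num), ← hite 5 (by norm_num) (by norm_num),
    sumInvCoprimeThirty,
    ← isMultiplicative_invCoprimeThirty.prodPrimeFactors_one_add_of_squarefree hsq,
    ← Finset.prod_mul_distrib, ← Finset.prod_mul_distrib, avoidingDensity,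
    ← Finset.prod_inv_distrib]
  refine Finset.prod_congr rfl fun p hp => ?_
  obtain ⟨hprime, hp2⟩ := primeFactors_prime_and_ne_two hodd p hp
  have hp0 : (0 : ℝ) < p := by exact_mod_cast hprime.pos
  have key : ((p : ℝ) / (p + 1))⁻¹ = 1 + (p : ℝ)⁻¹ := by field_simp
  rw [key, invCoprimeThirty_apply]
  by_cases h3 : p = 3
  · subst h3; norm_num
  by_cases h5 : p = 5
  · subst h5; norm_num
  have hc : Nat.Coprime 30 p := by
    rw [Nat.coprime_comm, hprime.coprime_iff_not_dvd]
    intro hd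
    rw [show 30 = 2 * (3 * 5) by norm_num, hprime.dvd_mul, hprime.dvd_mul,
      Nat.prime_dvd_prime_iff_eq hprime Nat.prime_two,
      Nat.prime_dvd_prime_iff_eq hprime Nat.prime_three,
      Nat.prime_dvd_prime_iff_eq hprime Nat.prime_five] at hd
    omega
  rw [if_neg h3, if_neg h5, if_pos hc, one_mul, one_mul]

/-- The odd vertices `l` with `gcd(l, 15) = a`. -/
def oddVerticesClass (n a : ℕ) : Finset ℕ := (oddVertices n).filter (fun l => l.gcd 15 = a)

theorem mem_oddVerticesClass {n a l : ℕ} :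
    l ∈ oddVerticesClass n a ↔ ((1 ≤ l ∧ l ≤ n) ∧ Squarefree l ∧ Odd l) ∧ l.gcd 15 = a := by
  simp only [oddVerticesClass, oddVertices, vertices, Finset.mem_filter, Finset.mem_Icc]
  tauto

theorem card_coprime_thirty_Icc_le (M : ℕ) :
    ((Finset.Icc 1 M).filter (fun m => Nat.Coprime 30 m)).card ≤ 8 * (M / 30 + 1) := by
  have h := Nat.Ico_filter_coprime_le (a := 30) 1 M (by norm_num)
  rw [show Nat.totient 30 = 8 by decide] at h
  have e : Finset.Ico 1 (1 + M) = Finset.Icc 1 M := by ext; simp; omega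
  rwa [e] at h

/-- Each counted `l` is `a * d * m` with `m` coprime to `30`. -/
theorem card_oddVerticesClass_dvd_le (n : ℕ) {a d : ℕ} (ha : a ∣ 15) (hd : Nat.Coprime 30 d) :
    ((oddVerticesClass n a).filter (fun l => d ∣ l)).card ≤ 8 * (n / (a * d) / 30 + 1) := by
  refine le_trans ?_ (card_coprime_thirty_Icc_le (n / (a * d)))
  have ha0 : 0 < a := Nat.pos_of_dvd_of_pos ha (by norm_num)
  have hd0 : 0 < d := Nat.pos_of_ne_zero (by rintro rfl; norm_num at hd)
  have hsub : (oddVerticesClass n a).filter (fun l => d ∣ l) ⊆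
      ((Finset.Icc 1 (n / (a * d))).filter (fun m => Nat.Coprime 30 m)).image
        (fun m => a * d * m) := by
    intro l hl
    rw [Finset.mem_filter, mem_oddVerticesClass] at hl
    obtain ⟨⟨⟨⟨h1, h2⟩, hsq, hodd⟩, hg⟩, hdl⟩ := hl
    have hal : a ∣ l := hg ▸ Nat.gcd_dvd_left l 15
    have hcop : Nat.Coprime a d := Nat.Coprime.coprime_dvd_left (ha.trans (by norm_num)) hd
    obtain ⟨m, rfl⟩ := hcop.mul_dvd_of_dvd_of_dvd hal hdl
    rw [Finset.mem_image]
    refine ⟨m, ?_, rfl⟩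
    rw [Finset.mem_filter, Finset.mem_Icc]
    refine ⟨⟨Nat.pos_of_mul_pos_left h1, ?_⟩, ?_⟩
    · rw [Nat.le_div_iff_mul_le (Nat.mul_pos ha0 hd0), mul_comm]
      exact h2
    · refine Nat.coprime_of_dvd fun q hq hq30 hqm => ?_
      have hql : q ∣ a * d * m := hqm.mul_left _
      have hq15 : q ∣ 15 := by
        rw [show 30 = 2 * 15 by norm_num, hq.dvd_mul] at hq30
        rcases hq30 with h | h
        · rw [Nat.prime_dvd_prime_iff_eq hq Nat.prime_two] at h
          subst h
          exact absurd (even_iff_two_dvd.2 hql) (Nat.not_even_iff_odd.2 hodd)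
        · exact h
      have hqa : q ∣ a := hg ▸ Nat.dvd_gcd hql hq15
      have hqq : q * q ∣ a * d * m := mul_dvd_mul (hqa.mul_right d) hqm
      exact hq.one_lt.ne' (Nat.isUnit_iff.1 (hsq q hqq))
  exact (Finset.card_le_card hsub).trans Finset.card_image_le

/-- Apart from `7, 11, 13`, only odd `d ≥ 17` occur; the sum over these is at most `1/32`. -/
theorem sum_inv_sq_coprime_thirty_le (n : ℕ) :
    ∑ d ∈ (Finset.Icc 2 n).filter (fun d => Nat.Coprime 30 d), 1 / (d : ℝ) ^ 2 ≤ 0.06584 := by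
  have hsub : (Finset.Icc 2 n).filter (fun d => Nat.Coprime 30 d) ⊆
      {7, 11, 13} ∪ (Finset.range n).image (fun j : ℕ => 2 * (j + 8) + 1) := by
    intro d hd
    rw [Finset.mem_filter, Finset.mem_Icc] at hd
    obtain ⟨⟨h2, hn⟩, hc⟩ := hd
    rw [Finset.mem_union, Finset.mem_image]
    by_cases h17 : 17 ≤ d
    · right
      have hodd : Odd d := Nat.coprime_two_left.1 (Nat.Coprime.coprime_dvd_left (by norm_num) hc)
      obtain ⟨k, rfl⟩ := hodd
      exact ⟨k - 8, Finset.mem_range.2 (by omega), by omega⟩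
    · left
      have h17' : d < 17 := not_le.1 h17
      clear hn h17
      interval_cases d <;> first | (exfalso; revert hc; decide) | decide
  refine (Finset.sum_le_sum_of_subset_of_nonneg hsub fun _ _ _ => by positivity).trans ?_
  have hinter := Finset.sum_union_inter (s₁ := ({7, 11, 13} : Finset ℕ))
    (s₂ := (Finset.range n).image (fun j : ℕ => 2 * (j + 8) + 1))
    (f := fun d : ℕ => 1 / (d : ℝ) ^ 2)
  have hnonneg : 0 ≤ ∑ d ∈ ({7, 11, 13} : Finset ℕ) ∩
      (Finset.range n).image (fun j : ℕ => 2 * (j + 8) + 1), 1 / (d : ℝ) ^ 2 :=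
    Finset.sum_nonneg fun _ _ => by positivity
  have h1 : ∑ d ∈ ({7, 11, 13} : Finset ℕ), 1 / (d : ℝ) ^ 2 ≤ 0.03459 := by norm_num
  have h2 : ∑ d ∈ (Finset.range n).image (fun j : ℕ => 2 * (j + 8) + 1), 1 / (d : ℝ) ^ 2
      ≤ 1 / 32 := by
    rw [Finset.sum_image fun a _ b _ h => by simpa using h]
    have h := sum_Ico_one_div_odd_sq_le (J := 8) (by norm_num) n
    have h0 : (0 : ℝ) ≤ 1 / (4 * ((n + 8 : ℕ) : ℝ)) := by positivity
    have e : (1 : ℝ) / (4 * ((8 : ℕ) : ℝ)) = 1 / 32 := by norm_num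
    rw [e] at h
    refine le_trans (le_of_eq (Finset.sum_congr rfl fun j _ => ?_)) (h.trans (by linarith))
    push_cast
    rfl
  linarith

theorem sum_inv_Icc_le (n : ℕ) : ∑ d ∈ Finset.Icc 1 n, (d : ℝ)⁻¹ ≤ 2 * √(n : ℝ) := by
  rcases Nat.eq_zero_or_pos n with rfl | hn
  · simp
  have h := harmonic_le_one_add_log n
  rw [harmonic_eq_sum_Icc] at h
  push_cast at h
  have hs : 0 < √(n : ℝ) := Real.sqrt_pos.2 (by exact_mod_cast hn)
  have h1 := Real.log_le_sub_one_of_pos hs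
  rw [Real.log_sqrt (Nat.cast_nonneg n)] at h1
  linarith

/-- Exchanging the sums over `l` and `d`, the main term is `(8/30) (n/a) ∑ 1/d²`, and the
rounding errors sum to at most `8 ∑ 1/d`. -/
theorem sum_sumInvCoprimeThirty_sub_one_le {n a : ℕ} (hn : 10 ^ 10 ≤ n) (ha : a ∣ 15) :
    ∑ l ∈ oddVerticesClass n a, (sumInvCoprimeThirty l - 1) ≤ (0.01756 / a + 0.00016) * n := by
  have ha0 : (0 : ℝ) < a := by exact_mod_cast Nat.pos_of_dvd_of_pos ha (by norm_num)
  have hn1 : 1 ≤ n := le_trans (by norm_num) hn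
  set D := (Finset.Icc 2 n).filter (fun d => Nat.Coprime 30 d) with hD
  have h1 : ∀ l ∈ oddVerticesClass n a,
      sumInvCoprimeThirty l - 1 = ∑ d ∈ D, if d ∣ l then (d : ℝ)⁻¹ else 0 := by
    intro l hl
    rw [mem_oddVerticesClass] at hl
    obtain ⟨⟨⟨hl1, hl2⟩, -⟩, -⟩ := hl
    have hdiv : l.divisors = (Finset.Icc 1 n).filter (fun d => d ∣ l) := by
      ext d
      simp only [Nat.mem_divisors, Finset.mem_filter, Finset.mem_Icc]
      constructor
      · rintro ⟨h, -⟩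
        exact ⟨⟨Nat.pos_of_dvd_of_pos h hl1, (Nat.le_of_dvd hl1 h).trans hl2⟩, h⟩
      · rintro ⟨-, h⟩
        exact ⟨h, by omega⟩
    rw [sumInvCoprimeThirty, hdiv, Finset.sum_filter, ← Finset.insert_Icc_add_one_left_eq_Icc hn1,
      Finset.sum_insert (by simp), hD, Finset.sum_filter]
    simp only [isUnit_one, IsUnit.dvd, if_true, invCoprimeThirty_apply,
      Nat.coprime_one_right_eq_true, Nat.cast_one, inv_one]
    rw [add_sub_cancel_left]
    refine Finset.sum_congr rfl fun d _ => ?_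
    split_ifs <;> rfl
  rw [Finset.sum_congr rfl h1, Finset.sum_comm]
  have h2 : ∀ d ∈ D, (∑ l ∈ oddVerticesClass n a, if d ∣ l then (d : ℝ)⁻¹ else 0)
      ≤ 8 * n / (30 * a) * (1 / (d : ℝ) ^ 2) + 8 * (d : ℝ)⁻¹ := by
    intro d hd
    rw [hD, Finset.mem_filter, Finset.mem_Icc] at hd
    have hd0 : (0 : ℝ) < d := by exact_mod_cast (by omega : 0 < d)
    rw [← Finset.sum_filter, Finset.sum_const, nsmul_eq_mul]
    have hc : (((oddVerticesClass n a).filter (fun l => d ∣ l)).card : ℝ)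
        ≤ 8 * ((n / (a * d) / 30 : ℕ) + 1) := by
      exact_mod_cast card_oddVerticesClass_dvd_le n ha hd.2
    have hq : ((n / (a * d) / 30 : ℕ) : ℝ) ≤ n / (a * d) / 30 := by
      refine Nat.cast_div_le.trans ?_
      push_cast
      gcongr
      refine Nat.cast_div_le.trans ?_
      push_cast
      rfl
    calc _ ≤ (8 * ((n : ℝ) / (a * d) / 30 + 1)) * (d : ℝ)⁻¹ := by
          gcongr
          exact hc.trans (by gcongr)
      _ = _ := by field_simp
  refine (Finset.sum_le_sum h2).trans ?_
  rw [Finset.sum_add_distrib, ← Finset.mul_sum, ← Finset.mul_sum]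
  have h3 := sum_inv_sq_coprime_thirty_le n
  have h4 : ∑ d ∈ D, (d : ℝ)⁻¹ ≤ 2 * √(n : ℝ) := by
    refine le_trans (Finset.sum_le_sum_of_subset_of_nonneg ?_ fun _ _ _ => by positivity)
      (sum_inv_Icc_le n)
    exact (Finset.filter_subset _ _).trans (Finset.Icc_subset_Icc_left one_le_two)
  have h5 := sqrt_le_of_ten_pow_le hn
  calc _ ≤ 8 * n / (30 * a) * 0.06584 + 8 * (2 * (0.00001 * (n : ℝ))) := by
        gcongr
        exact h4.trans (by linarith)
    _ = (8 / 30 * 0.06584 / a + 0.00016) * n := by ring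
    _ ≤ _ := by gcongr; norm_num

theorem one_le_sumInvCoprimeThirty {l : ℕ} (hl : l ≠ 0) : 1 ≤ sumInvCoprimeThirty l := by
  have h := Finset.single_le_sum (f := fun d => invCoprimeThirty d) (s := l.divisors)
    (fun d _ => by rw [invCoprimeThirty_apply]; split_ifs <;> positivity)
    (Nat.one_mem_divisors.2 hl)
  rwa [invCoprimeThirty_apply, if_pos (by norm_num), Nat.cast_one, inv_one] at h

/-- Markov's inequality for `τ - 1`, where `τ` is `sumInvCoprimeThirty`. Subtracting `1` matters:
`τ` has average below `1.1`, so that Markov's inequality for `τ` itself would be too weak. -/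
theorem card_mul_sub_one_le {n a : ℕ} (hn : 10 ^ 10 ≤ n) (ha : a ∣ 15) {B : Finset ℕ} {y : ℝ}
    (hB : B ⊆ oddVerticesClass n a) (hy : ∀ l ∈ B, y ≤ sumInvCoprimeThirty l) :
    (B.card : ℝ) * (y - 1) ≤ (0.01756 / a + 0.00016) * n := by
  refine le_trans ?_ (sum_sumInvCoprimeThirty_sub_one_le hn ha)
  rw [← nsmul_eq_mul]
  refine (Finset.card_nsmul_le_sum B _ (y - 1) fun l hl => sub_le_sub_right (hy l hl) 1).trans ?_
  refine Finset.sum_le_sum_of_subset_of_nonneg hB fun l hl _ => ?_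
  rw [mem_oddVerticesClass] at hl
  exact sub_nonneg.2 (one_le_sumInvCoprimeThirty (by omega))

theorem card_oddVerticesClass_fifteen_le {n : ℕ} (hn : 10 ^ 10 ≤ n) :
    ((oddVerticesClass n 15).card : ℝ) ≤ 0.01779 * n := by
  have h := card_oddVerticesClass_dvd_le n (a := 15) (d := 1) dvd_rfl (by norm_num)
  rw [Finset.filter_true_of_mem fun l _ => one_dvd l] at h
  have h' : 450 * (oddVerticesClass n 15).card ≤ 8 * n + 3600 := by omega
  have h'' : (450 : ℝ) * (oddVerticesClass n 15).card ≤ 8 * n + 3600 := by exact_mod_cast h'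
  have hnr : (10 : ℝ) ^ 10 ≤ n := by exact_mod_cast hn
  linarith

/-- A vertex coprime to few even vertices has a large product `∏ (1 + 1/p)`. -/
theorem le_inv_avoidingDensity {n l k : ℕ} (hn : 10 ^ 10 ≤ n) (hl : l ≤ n) (hodd : Odd l)
    (hk : evenCoprimeCount l n ≤ k) : 0.2018 * n ≤ k * (avoidingDensity l.primeFactors)⁻¹ := by
  have h := abs_evenCoprimeCount_sub_le hn hl hodd
  have hf := avoidingDensity_pos fun p hp => (primeFactors_prime_and_ne_two hodd p hp).1
  have hk' : (evenCoprimeCount l n : ℝ) ≤ k := by exact_mod_cast hk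
  have hpi : 0.2026 ≤ 2 / Real.pi ^ 2 := by
    rw [le_div_iff₀ (by positivity)]
    nlinarith [Real.pi_lt_d4, Real.pi_gt_three]
  rw [← div_eq_mul_inv, le_div_iff₀ hf]
  rw [abs_le] at h
  have h1 : 0.2026 * (avoidingDensity l.primeFactors * n)
      ≤ 2 / Real.pi ^ 2 * (avoidingDensity l.primeFactors * n) := by gcongr
  have h2 : 0 ≤ avoidingDensity l.primeFactors * n := by positivity
  linarith [h.1]

theorem card_filter_evenCoprimeCount_le {n k : ℕ} (hn : 10 ^ 10 ≤ n) (hk : (k : ℝ) ≤ threshold n) :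
    ((oddVertices n).filter (fun l => evenCoprimeCount l n ≤ k)).card ≤ k := by
  have hnr : (10 : ℝ) ^ 10 ≤ n := by exact_mod_cast hn
  set B := (oddVertices n).filter (fun l => evenCoprimeCount l n ≤ k) with hBdef
  have hB : ∀ l ∈ B, ((1 ≤ l ∧ l ≤ n) ∧ Squarefree l ∧ Odd l) ∧ evenCoprimeCount l n ≤ k := by
    intro l hl
    simp only [hBdef, oddVertices, vertices, Finset.mem_filter, Finset.mem_Icc] at hl
    tauto
  rcases Nat.eq_zero_or_pos k with rfl | hk0
  · -- no odd vertex qualifies, since each is coprime to some even vertex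
    rw [Nat.le_zero, Finset.card_eq_zero, Finset.eq_empty_iff_forall_notMem]
    intro l hl
    have h := le_inv_avoidingDensity hn (hB l hl).1.1.2 (hB l hl).1.2.2 (hB l hl).2
    rw [Nat.cast_zero, zero_mul] at h
    linarith
  have hkr : (0 : ℝ) < k := by exact_mod_cast hk0
  set t : ℝ := 0.2018 * n / k with ht
  have htk : t * k = 0.2018 * n := by rw [ht]; field_simp
  have hpi : 2 / Real.pi ^ 2 ≤ 0.2027 := by
    rw [div_le_iff₀ (by positivity)]
    nlinarith [Real.pi_gt_d4]
  have hkn : (k : ℝ) ≤ 0.672 * (0.2027 * n) := by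
    refine hk.trans ?_
    rw [threshold, show (1 / 3 : ℝ) * (6 / Real.pi ^ 2 * n) = 2 / Real.pi ^ 2 * n by ring]
    gcongr
  have ht1 : 1.48 ≤ t := by
    rw [ht, le_div_iff₀ hkr]
    linarith
  have hmarkov : ∀ a : ℕ, a ∣ 15 → ((B.filter (fun l => l.gcd 15 = a)).card : ℝ) *
      (t / smallFactor a - 1) ≤ (0.01756 / a + 0.00016) * n := by
    intro a ha
    refine card_mul_sub_one_le hn ha (fun l hl => ?_) fun l hl => ?_
    · rw [Finset.mem_filter] at hl
      exact mem_oddVerticesClass.2 ⟨(hB l hl.1).1, hl.2⟩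
    · rw [Finset.mem_filter] at hl
      obtain ⟨⟨⟨hl1, hln⟩, hsq, hodd⟩, hlk⟩ := hB l hl.1
      have h := le_inv_avoidingDensity hn hln hodd hlk
      rw [inv_avoidingDensity_eq hsq hodd, hl.2] at h
      have hs : 0 < smallFactor a := by unfold smallFactor; positivity
      rw [div_le_iff₀ hs, ht, div_le_iff₀ hkr]
      linarith
  have hcard : B.card = ∑ a ∈ ({1, 3, 5, 15} : Finset ℕ),
      (B.filter (fun l => l.gcd 15 = a)).card := by
    refine Finset.card_eq_sum_card_fiberwise fun l _ => ?_
    have h : l.gcd 15 ∈ Nat.divisors 15 := Nat.mem_divisors.2 ⟨Nat.gcd_dvd_right l 15, by norm_num⟩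
    rwa [show Nat.divisors 15 = {1, 3, 5, 15} by decide] at h
  have hcard' : (B.card : ℝ) = (B.filter (fun l => l.gcd 15 = 1)).card
      + ((B.filter (fun l => l.gcd 15 = 3)).card
      + ((B.filter (fun l => l.gcd 15 = 5)).card
      + (B.filter (fun l => l.gcd 15 = 15)).card)) := by
    rw [hcard]
    simp
  have h1 := hmarkov 1 (by norm_num)
  have h3 := hmarkov 3 (by norm_num)
  have h5 := hmarkov 5 (by norm_num)
  have h15 := hmarkov 15 (by norm_num)
  -- for `a = 15` the level `t / θ` may be below `1`; adding the whole class to `h15` bounds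
  -- `x15 * (t / θ)`, which is what Markov's inequality for `τ` itself gives
  have hc15 : ((B.filter (fun l => l.gcd 15 = 15)).card : ℝ) ≤ 0.01779 * n := by
    refine le_trans ?_ (card_oddVerticesClass_fifteen_le hn)
    exact_mod_cast Finset.card_le_card (Finset.filter_subset_filter _ (Finset.filter_subset _ _))
  norm_num [smallFactor] at h1 h3 h5 h15
  have b1 : (0 : ℝ) ≤ (B.filter (fun l => l.gcd 15 = 1)).card := Nat.cast_nonneg _
  have b3 : (0 : ℝ) ≤ (B.filter (fun l => l.gcd 15 = 3)).card := Nat.cast_nonneg _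
  have b5 : (0 : ℝ) ≤ (B.filter (fun l => l.gcd 15 = 5)).card := Nat.cast_nonneg _
  generalize ((B.filter (fun l => l.gcd 15 = 1)).card : ℝ) = x1 at *
  generalize ((B.filter (fun l => l.gcd 15 = 3)).card : ℝ) = x3 at *
  generalize ((B.filter (fun l => l.gcd 15 = 5)).card : ℝ) = x5 at *
  generalize ((B.filter (fun l => l.gcd 15 = 15)).card : ℝ) = x15 at *
  -- for `θ = smallFactor a`, the ratio `t / (t / θ - 1)` decreases in `t`, and the constants are
  -- its values at `t = 1.48`, rounded up
  have y1 : x1 * t ≤ 3.0834 * (x1 * (t - 1)) := by nlinarith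
  have y3 : x3 * t ≤ 13.455 * (x3 * (t / (4 / 3) - 1)) := by nlinarith
  have y5 : x5 * t ≤ 6.343 * (x5 * (t / (6 / 5) - 1)) := by nlinarith
  have hfin : (B.card : ℝ) * t ≤ k * t := by
    rw [mul_comm (k : ℝ), htk, hcard']
    linarith
  exact_mod_cast le_of_mul_le_mul_right hfin (by linarith)

theorem lemma3 (n : ℕ) (hn : 10 ^ 10 ≤ n) :
    (∀ k : ℕ, (k : ℝ) ≤ threshold n →
      ((oddVertices n).filter (fun l => evenCoprimeCount l n ≤ k)).card ≤ k) ∧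
    (∀ l ∈ oddVertices n, threshold n < (evenCoprimeCount l n : ℝ) →
      oddSharingCount l n ≤ evenCoprimeCount l n) := by
  refine ⟨fun k hk => card_filter_evenCoprimeCount_le hn hk, fun l hl hK => ?_⟩
  simp only [oddVertices, vertices, Finset.mem_filter, Finset.mem_Icc] at hl
  exact oddSharingCount_le_evenCoprimeCount hn hl.1.1.2 hl.2 hK
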